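/- Let $\mathbb T$ be the unit circle, $m$ the normalized Lebesgue measure on $\mathbb T$, and $a_{-1}\in\mathbb T$. Let $\sigma$ be a Borel probability measure on $\mathbb T$ of the Szegő class, that is, $d\sigma=w\,dm+d\sigma_s$ with $\sigma_s$ singular with respect to $m$, $w>0$ $m$-almost everywhere and $\log w\in L^1(m)$. Put $$R(z)=\int_{\mathbb T}\frac{t+z}{t-z}\,d\sigma(t),\qquad D(z)=\exp\Big(\frac12\int_{\mathbb T}\frac{t+z}{t-z}\log w(t)\,dm(t)\Big)\quad(|z|<1),\qquad D_*(z)=\overline{D(1/\bar z)}\quad(|z|>1).$$ Let $M(\sigma,a_{-1})$ be the set of pairs $\mathcal F=(F_1,F_2)$ such that $F_1$ is analytic for $|z|<1$, $F_2$ is analytic for $|z|>1$ with $F_2(z)\to0$ as $z\to\infty$, and $$\|\mathcal F\|_{M(\sigma,a_{-1})}^2=\sup_{0<r<1}\int_{\mathbb T}\big|(DF_1)(rt)-\bar a_{-1}(D_*F_2)(t/r)\big|^2\,\frac{dm(t)}{\operatorname{Re}R(rt)}<\infty .$$ Then a pair $\mathcal F=(F_1,F_2)$ of functions, $F_1$ on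 $\{|z|<1\}$ and $F_2$ on $\{|z|>1\}$, belongs to $M(\sigma,a_{-1})$ if and only if there is $f\in L^2_{d\sigma}$ such that $$F_1(z)=\frac1{D(z)}\int_{\mathbb T}\frac{t}{t-z}f(t)\,d\sigma(t)\quad(|z|<1),\qquad F_2(z)=\frac{a_{-1}}{D_*(z)}\int_{\mathbb T}\frac{t}{t-z}f(t)\,d\sigma(t)\quad(|z|>1).$$ Moreover, for every such $f$, $\|\mathcal F\|_{M(\sigma,a_{-1})}=\|f\|_{L^2_{d\sigma}}$. -/

import Mathlib

open MeasureTheory Filter Topology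
open scoped ENNReal ComplexConjugate

noncomputable section

/-- The unit circle carries its Borel σ-algebra. -/
instance Circle.instMeasurableSpaceBorel : MeasurableSpace Circle := borel Circle

instance Circle.instBorelSpaceBorel : BorelSpace Circle := ⟨rfl⟩

namespace Scattering

/-- Normalized Lebesgue measure `m` on the unit circle, `m(𝕋) = 1`: the image of the Haar
probability measure of `ℝ / ℤ` under `x ↦ exp (2 π i x)`. -/
def circleLebesgue : Measure Circle :=
  (AddCircle.haarAddCircle (T := (1 : ℝ))).map AddCircle.toCircle

/-- The density `w` of the absolutely continuous part of `σ`: `dσ = w dm + dσ_s`. -/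
def weight (σ : Measure Circle) (t : Circle) : ℝ :=
  (σ.rnDeriv circleLebesgue t).toReal

/-- The Szegő condition `log w ∈ L¹(m)`. Since `Real.log 0 = 0`, positivity of `w` almost
everywhere (that is, `log w ≠ -∞`) is stated separately. -/
def IsSzego (σ : Measure Circle) : Prop :=
  (∀ᵐ t ∂circleLebesgue, 0 < weight σ t) ∧
    Integrable (fun t => Real.log (weight σ t)) circleLebesgue

/-- The outer function `D(z) = exp (½ ∫ (t + z) / (t - z) log w(t) dm(t))`, for `|z| < 1`. -/
def outerD (σ : Measure Circle) (z : ℂ) : ℂ :=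
  Complex.exp ((1 / 2 : ℂ) *
    ∫ t : Circle, (((t : ℂ) + z) / ((t : ℂ) - z)) * (Real.log (weight σ t) : ℂ) ∂circleLebesgue)

/-- `D_*(z)` is the complex conjugate of `D(1 / z̄)`, for `|z| > 1`. -/
def outerDStar (σ : Measure Circle) (z : ℂ) : ℂ :=
  conj (outerD σ (1 / conj z))

/-- `R(z) = ∫ (t + z) / (t - z) dσ(t)`. -/
def herglotzR (σ : Measure Circle) (z : ℂ) : ℂ :=
  ∫ t : Circle, ((t : ℂ) + z) / ((t : ℂ) - z) ∂σ

/-- The Cauchy-type integral `∫ t / (t - z) f(t) dσ(t)`. -/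
def cauchyInt (σ : Measure Circle) (f : Circle → ℂ) (z : ℂ) : ℂ :=
  ∫ t : Circle, ((t : ℂ) / ((t : ℂ) - z)) * f t ∂σ

/-- `F = (F₁, F₂)` is the scattering representation of `f ∈ L²(σ)`. -/
def IsScatteringTransform (σ : Measure Circle) (a : Circle) (f : Lp ℂ 2 σ)
    (F : (ℂ → ℂ) × (ℂ → ℂ)) : Prop :=
  (∀ z : ℂ, ‖z‖ < 1 → F.1 z = 1 / outerD σ z * cauchyInt σ f z) ∧
    (∀ z : ℂ, 1 < ‖z‖ → F.2 z = (a : ℂ) / outerDStar σ z * cauchyInt σ f z)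

/-- `∫ |(D F₁)(r t) - ā (D_* F₂)(t / r)|² / Re R(r t) dm(t)`, for `0 < r < 1`. Here
`t / r = 1 / z̄` for `z = r t`. -/
def hellingerIntegral (σ : Measure Circle) (a : Circle) (F : (ℂ → ℂ) × (ℂ → ℂ)) (r : ℝ) : ℝ≥0∞ :=
  ∫⁻ t : Circle, ENNReal.ofReal
    (‖outerD σ (r * (t : ℂ)) * F.1 (r * (t : ℂ))
        - conj (a : ℂ) * (outerDStar σ ((t : ℂ) / r) * F.2 ((t : ℂ) / r))‖ ^ 2
      / (herglotzR σ (r * (t : ℂ))).re) ∂circleLebesgue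

/-- The norm of `M(σ, a)`, with value `∞` allowed. -/
def mNorm (σ : Measure Circle) (a : Circle) (F : (ℂ → ℂ) × (ℂ → ℂ)) : ℝ≥0∞ :=
  (⨆ r ∈ Set.Ioo (0 : ℝ) 1, hellingerIntegral σ a F r) ^ (1 / 2 : ℝ)

/-- `F = (F₁, F₂) ∈ M(σ, a)`: `F₁` is analytic for `|z| < 1`, `F₂` is analytic for `|z| > 1`
with `F₂(∞) = 0`, and the norm is finite. -/
def MemM (σ : Measure Circle) (a : Circle) (F : (ℂ → ℂ) × (ℂ → ℂ)) : Prop :=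
  AnalyticOnNhd ℂ F.1 {z : ℂ | ‖z‖ < 1} ∧
    AnalyticOnNhd ℂ F.2 {z : ℂ | 1 < ‖z‖} ∧
    Tendsto F.2 (Bornology.cobounded ℂ) (𝓝 0) ∧
    mNorm σ a F < ∞

end Scattering

end

/-!
The jump of a Cauchy integral `∫ t / (t - z) f dσ` between the symmetric points `r s` and `s / r`
is the Poisson integral `P[f dσ](r s)`, and `Re R(r s)` is the Poisson integral of `σ`. After
multiplication by `D` and `ā D_*` the theorem becomes a statement about functions
`u(r s) = G₁(r s) - G₂(s / r)`, with `G₁` analytic inside the circle and `G₂` outside and vanishing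
at infinity: the integrals `∫ |u(r s)|² / P[σ](r s) dm(s)` are bounded in `r` exactly when
`u = P[f dσ]` for some `f ∈ L²(σ)`, and their supremum is then `‖f‖²`.

The upper bound `weightedEnergy_poissonInt_le` is the Cauchy–Schwarz inequality under the Poisson
integral, `|P[f dσ]|² ≤ P[σ] P[|f|² dσ]`, integrated over the circle. For the lower bound, weighted
Cauchy–Schwarz gives `|∫ g u_r dm|² ≤ S² ∫ |g|² P[σ](r s) dm` for continuous `g`, where `S²` bounds
the energies; since `P[h dσ](r s) dm` converges weakly to `h dσ` as `r → 1`
(`tendsto_integral_mul_poissonInt`), the limit functional on `C(𝕋)` is bounded by `S` in the norm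
of `L²(σ)` (`norm_le_of_tendsto_of_weightedEnergy_le`), and continuous functions are dense there.

The same estimate yields the converse: for arbitrary `F` of finite norm, a limit of the functionals
`g ↦ ∫ g u_r dm` along an ultrafilter extends to `L²(σ)` and is represented by some `f`
(`exists_Lp_of_weightedEnergy_le`). Evaluated on the Cauchy kernel `g(t) = t / (t - z)`, Cauchy's
formula identifies the limit as `G₁(z)` for `|z| < 1` and as `G₂(z)` for `|z| > 1`, which is the
required representation.
-/

noncomputable section

namespace Scattering

/-! ### Normalized Lebesgue measure and Cauchy's formula -/

theorem _root_.Continuous.integrable_circle {E : Type*} [NormedAddCommGroup E]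
    {μ : Measure Circle} [IsFiniteMeasure μ] {g : Circle → E} (hg : Continuous g) :
    Integrable g μ :=
  hg.integrable_of_hasCompactSupport (HasCompactSupport.of_compactSpace _)

instance isProbabilityMeasure_circleLebesgue : IsProbabilityMeasure circleLebesgue :=
  Measure.isProbabilityMeasure_map AddCircle.continuous_toCircle.measurable.aemeasurable

theorem integral_circleLebesgue {g : ℂ → ℂ} (hg : Continuous fun t : Circle => g t) :
    ∫ t : Circle, g t ∂circleLebesgue = Real.circleAverage g 0 1 := by
  rw [circleLebesgue, integral_map AddCircle.continuous_toCircle.measurable.aemeasurable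
    hg.aestronglyMeasurable, AddCircle.integral_haarAddCircle, inv_one, one_smul,
    ← AddCircle.intervalIntegral_preimage 1 0, Real.circleAverage_def]
  simp only [zero_add, AddCircle.toCircle_apply_mk, div_one, Circle.coe_exp]
  have h := intervalIntegral.integral_comp_mul_left (a := 0) (b := 1)
    (fun θ : ℝ => g (Complex.exp (θ * Complex.I))) (c := 2 * Real.pi) (by positivity)
  simpa [circleMap_zero] using h

/-- Cauchy's integral formula, with the contour integral written against `m`. -/
theorem integral_cauchyKernel_mul {H : ℂ → ℂ} {s : Set ℂ}
    (hball : Metric.closedBall 0 1 ⊆ s) (hH : DifferentiableOn ℂ H s) {z : ℂ} (hz : ‖z‖ < 1) :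
    ∫ t : Circle, (t : ℂ) / (t - z) * H t ∂circleLebesgue = H z := by
  have hd : DiffContOnCl ℂ H (Metric.ball 0 |1|) := by
    rw [abs_one]
    refine DifferentiableOn.diffContOnCl ?_
    rw [closure_ball 0 one_ne_zero]
    exact hH.mono hball
  have hne : ∀ t : Circle, (t : ℂ) - z ≠ 0 := fun t h => by
    rw [← sub_eq_zero.1 h, Circle.norm_coe] at hz
    exact lt_irrefl _ hz
  have hc : Continuous fun t : Circle => H t :=
    hH.continuousOn.comp_continuous (by fun_prop) fun t => hball (by simp [Circle.norm_coe])
  rw [integral_circleLebesgue (g := fun w => w / (w - z) * H w)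
    ((Continuous.div (by fun_prop) (by fun_prop) hne).mul hc)]
  simpa using hd.circleAverage_smul_div (w := z) (by simpa using hz)

theorem integral_of_differentiableOn {H : ℂ → ℂ} {s : Set ℂ}
    (hball : Metric.closedBall 0 1 ⊆ s) (hH : DifferentiableOn ℂ H s) :
    ∫ t : Circle, H t ∂circleLebesgue = H 0 := by
  rw [← integral_cauchyKernel_mul hball hH (z := 0) (by simp)]
  simp

theorem integral_circleLebesgue_inv {g : Circle → ℂ} (hg : Continuous g) :
    ∫ t : Circle, g t⁻¹ ∂circleLebesgue = ∫ t : Circle, g t ∂circleLebesgue := by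
  have : Measure.map (fun t : Circle => t⁻¹) circleLebesgue = circleLebesgue := by
    rw [circleLebesgue, Measure.map_map (by fun_prop)
      AddCircle.continuous_toCircle.measurable]
    have : (fun t : Circle => t⁻¹) ∘ (AddCircle.toCircle (T := (1 : ℝ)))
        = AddCircle.toCircle ∘ Neg.neg := by
      ext x
      simp [AddCircle.toCircle_neg]
    rw [this, ← Measure.map_map AddCircle.continuous_toCircle.measurable (by fun_prop),
      (Measure.measurePreserving_neg _).map_eq]
  conv_rhs => rw [← this]
  rw [integral_map (by fun_prop) hg.aestronglyMeasurable]

/-! ### The Poisson kernel -/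

/-- The Poisson kernel `(1 - r²) / |t - r s|²` at the point `r s` of the disc. -/
def poissonKer (r : ℝ) (s t : Circle) : ℝ :=
  (1 - r ^ 2) / ‖(t : ℂ) - r * s‖ ^ 2

section

variable {r : ℝ}

theorem coe_sub_ne_zero (t : Circle) {z : ℂ} (hz : ‖z‖ ≠ 1) : (t : ℂ) - z ≠ 0 := fun h =>
  hz (by rw [← sub_eq_zero.1 h, Circle.norm_coe])

theorem norm_mul_coe_lt (hr : r ∈ Set.Ioo (0 : ℝ) 1) (s : Circle) : ‖(r : ℂ) * s‖ < 1 := by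
  simpa [abs_of_pos hr.1, Circle.norm_coe] using hr.2

theorem one_lt_norm_coe_div (hr : r ∈ Set.Ioo (0 : ℝ) 1) (s : Circle) : 1 < ‖(s : ℂ) / r‖ := by
  simpa [abs_of_pos hr.1, Circle.norm_coe] using (one_lt_inv₀ hr.1).2 hr.2

theorem one_sub_le_norm (hr : r ∈ Set.Ioo (0 : ℝ) 1) (s t : Circle) :
    1 - r ≤ ‖(t : ℂ) - r * s‖ := by
  simpa [abs_of_pos hr.1, Circle.norm_coe] using norm_sub_norm_le (t : ℂ) (r * s)

theorem poissonKer_pos (hr : r ∈ Set.Ioo (0 : ℝ) 1) (s t : Circle) : 0 < poissonKer r s t := by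
  have h1 := hr.1
  have h2 := hr.2
  have := one_sub_le_norm hr s t
  exact div_pos (by nlinarith) (pow_pos (by linarith) 2)

theorem poissonKer_comm (r : ℝ) (s t : Circle) : poissonKer r s t = poissonKer r t s := by
  have h : ∀ s t : Circle, ‖(t : ℂ) - r * s‖ ^ 2
      = 1 + r ^ 2 - 2 * r * (s.1.re * t.1.re + s.1.im * t.1.im) := by
    intro s t
    have hs := Circle.normSq_coe s
    have ht := Circle.normSq_coe t
    rw [Complex.normSq_apply] at hs ht
    rw [← Complex.normSq_eq_norm_sq, Complex.normSq_apply]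
    simp only [Complex.sub_re, Complex.mul_re, Complex.ofReal_re, Complex.ofReal_im, zero_mul,
      sub_zero, Complex.sub_im, Complex.mul_im, add_zero]
    linear_combination ht + r ^ 2 * hs
  rw [poissonKer, poissonKer, h, h]
  ring_nf

theorem continuous_poissonKer (hr : r ∈ Set.Ioo (0 : ℝ) 1) :
    Continuous fun p : Circle × Circle => poissonKer r p.1 p.2 := by
  unfold poissonKer
  refine continuous_const.div (by fun_prop) fun p => pow_ne_zero 2 ?_
  have := one_sub_le_norm hr p.1 p.2
  have := hr.2
  linarith

theorem continuous_poissonKer_right (hr : r ∈ Set.Ioo (0 : ℝ) 1) (s : Circle) :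
    Continuous (poissonKer r s) :=
  (continuous_poissonKer hr).comp (by fun_prop : Continuous fun t : Circle => (s, t))

theorem poissonKer_le (hr : r ∈ Set.Ioo (0 : ℝ) 1) (s t : Circle) :
    poissonKer r s t ≤ (1 - r ^ 2) / (1 - r) ^ 2 := by
  have h1 := hr.1
  have h2 := hr.2
  have := one_sub_le_norm hr s t
  have : 0 < (1 - r) ^ 2 := pow_pos (by linarith) 2
  unfold poissonKer
  gcongr
  · nlinarith

theorem mul_conj_coe (t : Circle) : (t : ℂ) * conj (t : ℂ) = 1 := by
  rw [Complex.mul_conj, Circle.normSq_coe, Complex.ofReal_one]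

/-- The Poisson kernel at `r s` is the jump of the Cauchy kernel between the symmetric points
`r s` and `s / r`. -/
theorem cauchyKernel_sub (hr : r ∈ Set.Ioo (0 : ℝ) 1) (s t : Circle) :
    (t : ℂ) / (t - r * s) - t / (t - s / r) = poissonKer r s t := by
  have h0 : (r : ℂ) ≠ 0 := by exact_mod_cast hr.1.ne'
  have h1 := coe_sub_ne_zero t (norm_mul_coe_lt hr s).ne
  have h2 := coe_sub_ne_zero t (one_lt_norm_coe_div hr s).ne'
  have h3 : conj ((t : ℂ) - r * s) ≠ 0 := (map_ne_zero _).2 h1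
  have hs := mul_conj_coe s
  have ht := mul_conj_coe t
  rw [poissonKer]
  push_cast
  rw [← Complex.mul_conj', eq_div_iff (mul_ne_zero h1 h3)]
  have h4 : (t : ℂ) / (t - s / r) = -(r * conj (s : ℂ)) / conj ((t : ℂ) - r * s) := by
    rw [div_eq_div_iff h2 h3]
    simp only [map_sub, map_mul, Complex.conj_ofReal]
    field_simp
    linear_combination ht - hs
  rw [h4]
  field_simp
  simp only [map_sub, map_mul, Complex.conj_ofReal]
  linear_combination ht - r ^ 2 * hs

theorem re_herglotzKernel (hr : r ∈ Set.Ioo (0 : ℝ) 1) (s t : Circle) :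
    (((t : ℂ) + r * s) / (t - r * s)).re = poissonKer r s t := by
  have h1 := coe_sub_ne_zero t (norm_mul_coe_lt hr s).ne
  have hs := Circle.normSq_coe s
  have ht := Circle.normSq_coe t
  rw [Complex.normSq_apply] at hs ht
  have h5 : Complex.normSq ((t : ℂ) - r * s) ≠ 0 := by simpa using h1
  rw [poissonKer, ← Complex.normSq_eq_norm_sq, Complex.div_re, ← add_div]
  congr 1
  simp
  linear_combination ht - r ^ 2 * hs

theorem integral_poissonKer (hr : r ∈ Set.Ioo (0 : ℝ) 1) (s : Circle) :
    ∫ t, poissonKer r s t ∂circleLebesgue = 1 := by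
  have h1 := integral_cauchyKernel_mul (Set.subset_univ _)
    (differentiableOn_const (1 : ℂ)) (norm_mul_coe_lt hr s)
  have hne := fun t => coe_sub_ne_zero t (norm_mul_coe_lt hr s).ne
  have hc : Continuous fun t : Circle => (t : ℂ) / (t - r * s) :=
    Continuous.div (by fun_prop) (by fun_prop) hne
  have hi := hc.integrable_circle (μ := circleLebesgue)
  have h2 : ∀ t : Circle, poissonKer r s t
      = RCLike.re (2 * ((t : ℂ) / (t - r * s)) - 1) := by
    intro t
    rw [← re_herglotzKernel hr, ← RCLike.re_eq_complex_re]
    refine congrArg RCLike.re ?_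
    have := hne t
    field_simp
    ring
  simp_rw [h2]
  rw [integral_re (f := fun t : Circle => 2 * ((t : ℂ) / (t - r * s)) - 1)
      ((hi.const_mul 2).sub (integrable_const 1)),
    integral_sub (hi.const_mul 2) (integrable_const 1), integral_const_mul]
  simp only [mul_one] at h1
  rw [h1]
  norm_num

/-- The Poisson kernel is an approximate identity on the circle. -/
theorem tendsto_integral_poissonKer {g : Circle → ℂ} (hg : Continuous g) (s : Circle) :
    Tendsto (fun r => ∫ t, poissonKer r s t • g t ∂circleLebesgue) (𝓝[<] 1) (𝓝 (g s)) := by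
  have hev : ∀ᶠ r : ℝ in 𝓝[<] 1, r ∈ Set.Ioo (0 : ℝ) 1 := Ioo_mem_nhdsLT one_pos
  refine tendsto_integral_peak_smul_of_integrable_of_tendsto (t := Set.univ) (x₀ := s)
    MeasurableSet.univ univ_mem (measure_ne_top _ _) ?_ ?_ ?_ ?_
    hg.integrable_circle hg.continuousAt
  · filter_upwards [hev] with r hr t using (poissonKer_pos hr s t).le
  · intro u hu hs
    obtain ⟨δ, hδ, hball⟩ := Metric.isOpen_iff.1 hu s hs
    -- Off `u` the denominator `|t - r s|` is at least `δ - (1 - r)`.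
    have hlim : Tendsto (fun r : ℝ => (1 - r ^ 2) / (δ - (1 - r)) ^ 2) (𝓝[<] 1) (𝓝 0) := by
      have : ContinuousAt (fun r : ℝ => (1 - r ^ 2) / (δ - (1 - r)) ^ 2) 1 :=
        ContinuousAt.div (by fun_prop) (by fun_prop) (by simpa using hδ.ne')
      simpa [ContinuousAt] using this.tendsto.mono_left nhdsWithin_le_nhds
    rw [Metric.tendstoUniformlyOn_iff]
    intro ε hε
    filter_upwards [hev, hlim.eventually_lt_const hε,
      Ioo_mem_nhdsLT (show 1 - δ < 1 by linarith)] with r hr hlt hr' t ht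
    have h1 : δ ≤ ‖(t : ℂ) - s‖ := by
      have : ¬ dist t s < δ := fun h => ht (hball h)
      rw [not_lt] at this
      exact this.trans_eq (dist_eq_norm (t : ℂ) s)
    have h2 : ‖(t : ℂ) - s‖ ≤ ‖(t : ℂ) - r * s‖ + (1 - r) := by
      have h3 : (t : ℂ) - s = (t - r * s) - ((1 - r : ℝ) : ℂ) * s := by push_cast; ring
      have h4 : ‖((1 - r : ℝ) : ℂ) * s‖ = 1 - r := by
        rw [norm_mul, Circle.norm_coe, mul_one, Complex.norm_real, Real.norm_eq_abs,
          abs_of_pos (by linarith [hr.2])]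
      calc ‖(t : ℂ) - s‖ ≤ ‖(t : ℂ) - r * s‖ + ‖((1 - r : ℝ) : ℂ) * s‖ := h3 ▸ norm_sub_le _ _
        _ = _ := by rw [h4]
    have h5 : 0 < δ - (1 - r) := by linarith [hr'.1]
    rw [Pi.zero_apply, dist_zero_left, Real.norm_eq_abs, abs_of_pos (poissonKer_pos hr s t)]
    refine lt_of_le_of_lt ?_ hlt
    have h6 : 0 ≤ 1 - r ^ 2 := by nlinarith [hr.1, hr.2]
    unfold poissonKer
    gcongr
    linarith
  · refine tendsto_const_nhds.congr' ?_
    filter_upwards [hev] with r hr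
    rw [setIntegral_univ, integral_poissonKer hr]
  · filter_upwards [hev] with r hr
    exact (continuous_poissonKer_right hr s).aestronglyMeasurable

theorem integrable_poissonKer_mul {μ : Measure Circle} {f : Circle → ℂ} (hf : Integrable f μ)
    (hr : r ∈ Set.Ioo (0 : ℝ) 1) (s : Circle) :
    Integrable (fun t => (poissonKer r s t : ℂ) * f t) μ := by
  refine hf.bdd_mul (c := (1 - r ^ 2) / (1 - r) ^ 2) (Continuous.aestronglyMeasurable ?_)
    (ae_of_all _ fun t => ?_)
  · exact Complex.continuous_ofReal.comp (continuous_poissonKer_right hr s)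
  · rw [Complex.norm_real, Real.norm_eq_abs, abs_of_pos (poissonKer_pos hr s t)]
    exact poissonKer_le hr s t

/-- The Poisson integral of the complex measure `f dμ`, at the point `r s` of the disc. -/
def poissonInt (μ : Measure Circle) (f : Circle → ℂ) (r : ℝ) (s : Circle) : ℂ :=
  ∫ t, (poissonKer r s t : ℂ) * f t ∂μ

theorem continuous_poissonInt {μ : Measure Circle} {f : Circle → ℂ} (hf : Integrable f μ)
    (hr : r ∈ Set.Ioo (0 : ℝ) 1) : Continuous (poissonInt μ f r) := by
  refine continuous_of_dominated (bound := fun t => (1 - r ^ 2) / (1 - r) ^ 2 * ‖f t‖)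
    (fun s => (integrable_poissonKer_mul hf hr s).aestronglyMeasurable)
    (fun s => ae_of_all _ fun t => ?_) (hf.norm.const_mul _) (ae_of_all _ fun t => ?_)
  · rw [norm_mul, Complex.norm_real, Real.norm_eq_abs, abs_of_pos (poissonKer_pos hr s t)]
    gcongr
    exact poissonKer_le hr s t
  · exact (Complex.continuous_ofReal.comp ((continuous_poissonKer hr).comp (by fun_prop :
      Continuous fun s : Circle => (s, t)))).mul continuous_const

/-- Symmetry of the Poisson kernel moves the Poisson integral onto the test function. -/
theorem integral_mul_poissonInt {μ : Measure Circle} [IsFiniteMeasure μ] {f g : Circle → ℂ}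
    (hf : Integrable f μ) (hg : Continuous g) (hr : r ∈ Set.Ioo (0 : ℝ) 1) :
    ∫ s, g s * poissonInt μ f r s ∂circleLebesgue
      = ∫ t, (∫ s, poissonKer r t s • g s ∂circleLebesgue) * f t ∂μ := by
  have hint : Integrable (Function.uncurry fun s t : Circle =>
      (g s * (poissonKer r s t : ℂ)) * f t) (circleLebesgue.prod μ) := by
    have hc : Continuous fun p : Circle × Circle => g p.1 * (poissonKer r p.1 p.2 : ℂ) :=
      (hg.comp continuous_fst).mul (Complex.continuous_ofReal.comp (continuous_poissonKer hr))
    obtain ⟨C, hC⟩ := isCompact_univ.exists_bound_of_continuousOn hc.continuousOn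
    exact (hf.comp_snd circleLebesgue).bdd_mul (c := C) hc.aestronglyMeasurable
      (ae_of_all _ fun p => hC p trivial)
  have hswap := integral_integral_swap hint
  calc ∫ s, g s * poissonInt μ f r s ∂circleLebesgue
      = ∫ s, ∫ t, (g s * (poissonKer r s t : ℂ)) * f t ∂μ ∂circleLebesgue := by
        simp_rw [poissonInt, ← integral_const_mul, mul_assoc]
    _ = _ := hswap
    _ = _ := by
        refine integral_congr_ae (ae_of_all _ fun t => ?_)
        simp only []
        rw [integral_mul_const]
        simp_rw [poissonKer_comm r _ t, Complex.real_smul, mul_comm (g _)]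

theorem norm_integral_poissonKer_smul_le {g : Circle → ℂ} {C : ℝ} (hC : ∀ t, ‖g t‖ ≤ C)
    (hr : r ∈ Set.Ioo (0 : ℝ) 1) (s : Circle) :
    ‖∫ t, poissonKer r s t • g t ∂circleLebesgue‖ ≤ C := by
  have hi : Integrable (fun t => poissonKer r s t) circleLebesgue :=
    (continuous_poissonKer_right hr s).integrable_circle
  refine (norm_integral_le_of_norm_le (hi.mul_const C) (ae_of_all _ fun t => ?_)).trans_eq ?_
  · rw [norm_smul, Real.norm_eq_abs, abs_of_pos (poissonKer_pos hr s t)]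
    have := (poissonKer_pos hr s t).le
    gcongr
    exact hC t
  · rw [integral_mul_const, integral_poissonKer hr, one_mul]

/-- The measures `(Poisson integral of f dμ) dm` converge weakly to `f dμ`. -/
theorem tendsto_integral_mul_poissonInt {μ : Measure Circle} [IsFiniteMeasure μ]
    {f g : Circle → ℂ} (hf : Integrable f μ) (hg : Continuous g) :
    Tendsto (fun r => ∫ s, g s * poissonInt μ f r s ∂circleLebesgue) (𝓝[<] 1)
      (𝓝 (∫ t, g t * f t ∂μ)) := by
  have hev : ∀ᶠ r : ℝ in 𝓝[<] 1, r ∈ Set.Ioo (0 : ℝ) 1 := Ioo_mem_nhdsLT one_pos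
  obtain ⟨C, hC⟩ := isCompact_univ.exists_bound_of_continuousOn hg.continuousOn
  refine Tendsto.congr' (f₁ := fun r =>
    ∫ t, (∫ s, poissonKer r t s • g s ∂circleLebesgue) * f t ∂μ) ?_ ?_
  · filter_upwards [hev] with r hr using (integral_mul_poissonInt hf hg hr).symm
  · refine tendsto_integral_filter_of_dominated_convergence (fun t => C * ‖f t‖) ?_ ?_
      (hf.norm.const_mul C) (ae_of_all _ fun t => (tendsto_integral_poissonKer hg t).mul_const _)
    · filter_upwards [hev] with r hr
      have : (fun t => ∫ s, poissonKer r t s • g s ∂circleLebesgue)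
          = poissonInt circleLebesgue g r := by
        ext t
        simp only [poissonInt, Complex.real_smul]
      have hc := continuous_poissonInt (hg.integrable_circle : Integrable g circleLebesgue) hr
      rw [← this] at hc
      exact hc.aestronglyMeasurable.mul hf.aestronglyMeasurable
    · filter_upwards [hev] with r hr
      refine ae_of_all _ fun t => ?_
      rw [norm_mul]
      gcongr
      exact norm_integral_poissonKer_smul_le (fun t => hC t trivial) hr t

end

/-! ### The weighted Hellinger integral as a dual norm -/

section

theorem norm_integral_mul_sq_le {α : Type*} [MeasurableSpace α] {μ : Measure α} {a b : α → ℂ}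
    (ha : MemLp a 2 μ) (hb : MemLp b 2 μ) :
    ‖∫ x, a x * b x ∂μ‖ ^ 2 ≤ (∫ x, ‖a x‖ ^ 2 ∂μ) * ∫ x, ‖b x‖ ^ 2 ∂μ := by
  have h := integral_mul_norm_le_Lp_mul_Lq (μ := μ) (f := a) (g := b)
    Real.HolderConjugate.two_two (by simpa using ha) (by simpa using hb)
  simp only [Real.rpow_two, ← Real.sqrt_eq_rpow] at h
  have h1 : ‖∫ x, a x * b x ∂μ‖ ≤ ∫ x, ‖a x‖ * ‖b x‖ ∂μ := by
    simpa only [norm_mul] using norm_integral_le_integral_norm (μ := μ) fun x => a x * b x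
  calc ‖∫ x, a x * b x ∂μ‖ ^ 2
      ≤ (√(∫ x, ‖a x‖ ^ 2 ∂μ) * √(∫ x, ‖b x‖ ^ 2 ∂μ)) ^ 2 := by
        gcongr
        exact h1.trans h
    _ = _ := by
        rw [mul_pow, Real.sq_sqrt (integral_nonneg fun x => by positivity),
          Real.sq_sqrt (integral_nonneg fun x => by positivity)]

theorem Lp_two_norm_sq {α : Type*} [MeasurableSpace α] {μ : Measure α} (f : Lp ℂ 2 μ) :
    ‖f‖ ^ 2 = ∫ x, ‖f x‖ ^ 2 ∂μ := by
  have h : RCLike.re (inner ℂ f f) = ∫ x, ‖f x‖ ^ 2 ∂μ := by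
    rw [L2.inner_def, ← integral_re (L2.integrable_inner f f)]
    simp only [inner_self_eq_norm_sq]
  rw [← h, inner_self_eq_norm_sq]

theorem _root_.Continuous.memLp_two_circle {μ : Measure Circle} [IsFiniteMeasure μ]
    {g : Circle → ℂ} (hg : Continuous g) : MemLp g 2 μ := by
  obtain ⟨C, hC⟩ := isCompact_univ.exists_bound_of_continuousOn hg.continuousOn
  exact MemLp.of_bound hg.aestronglyMeasurable C (ae_of_all _ fun t => hC t trivial)

variable {σ : Measure Circle} {r : ℝ}

/-- The Poisson integral of the positive measure `σ` at the point `r s`; it equals `Re R(r s)`. -/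
def poissonDensity (σ : Measure Circle) (r : ℝ) (s : Circle) : ℝ :=
  ∫ t, poissonKer r s t ∂σ

theorem ofReal_poissonDensity (σ : Measure Circle) (r : ℝ) (s : Circle) :
    (poissonDensity σ r s : ℂ) = poissonInt σ (fun _ => 1) r s := by
  simp only [poissonDensity, poissonInt, mul_one]
  exact integral_ofReal.symm

theorem poissonDensity_pos [IsProbabilityMeasure σ] (hr : r ∈ Set.Ioo (0 : ℝ) 1) (s : Circle) :
    0 < poissonDensity σ r s := by
  rw [poissonDensity, integral_pos_iff_support_of_nonneg (fun t => (poissonKer_pos hr s t).le)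
    (continuous_poissonKer_right hr s).integrable_circle]
  have : Function.support (fun t => poissonKer r s t) = Set.univ :=
    Set.eq_univ_of_forall fun t => (poissonKer_pos hr s t).ne'
  simp [this]

theorem continuous_poissonDensity [IsFiniteMeasure σ] (hr : r ∈ Set.Ioo (0 : ℝ) 1) :
    Continuous (poissonDensity σ r) := by
  have h := Complex.continuous_re.comp
    (continuous_poissonInt (integrable_const (1 : ℂ) : Integrable _ σ) hr)
  refine h.congr fun s => ?_
  rw [Function.comp_apply, ← ofReal_poissonDensity, Complex.ofReal_re]

theorem re_herglotzR [IsFiniteMeasure σ] (hr : r ∈ Set.Ioo (0 : ℝ) 1) (s : Circle) :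
    (herglotzR σ (r * (s : ℂ))).re = poissonDensity σ r s := by
  have hc : Continuous fun t : Circle => ((t : ℂ) + r * s) / (t - r * s) :=
    Continuous.div (by fun_prop) (by fun_prop) fun t =>
      coe_sub_ne_zero t (norm_mul_coe_lt hr s).ne
  have h := integral_re (hc.integrable_circle (μ := σ))
  simp only [RCLike.re_eq_complex_re, re_herglotzKernel hr] at h
  exact h.symm

theorem tendsto_integral_norm_sq_mul_poissonDensity [IsFiniteMeasure σ] {g : Circle → ℂ}
    (hg : Continuous g) :
    Tendsto (fun r => ∫ s, ‖g s‖ ^ 2 * poissonDensity σ r s ∂circleLebesgue) (𝓝[<] 1)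
      (𝓝 (∫ t, ‖g t‖ ^ 2 ∂σ)) := by
  have h := tendsto_integral_mul_poissonInt (μ := σ) (integrable_const (1 : ℂ))
    (g := fun t => ((‖g t‖ ^ 2 : ℝ) : ℂ)) (Complex.continuous_ofReal.comp (hg.norm.pow 2))
  simp only [← ofReal_poissonDensity, mul_one] at h
  have h2 := (Complex.continuous_re.tendsto _).comp h
  have h3 : ∀ r, ∫ s, ((‖g s‖ ^ 2 : ℝ) : ℂ) * (poissonDensity σ r s : ℂ) ∂circleLebesgue
      = ((∫ s, ‖g s‖ ^ 2 * poissonDensity σ r s ∂circleLebesgue : ℝ) : ℂ) := fun r => by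
    rw [← integral_complex_ofReal]
    simp only [Complex.ofReal_mul]
  rw [integral_complex_ofReal] at h2
  simp only [Function.comp_def, h3, Complex.ofReal_re] at h2
  exact h2

/-- The integral `∫ |U(s)|² / Re R(r s) dm(s)`, with value `∞` allowed. -/
def weightedEnergy (σ : Measure Circle) (r : ℝ) (U : Circle → ℂ) : ℝ≥0∞ :=
  ∫⁻ s, ENNReal.ofReal (‖U s‖ ^ 2 / poissonDensity σ r s) ∂circleLebesgue

theorem continuous_energy [IsProbabilityMeasure σ] (hr : r ∈ Set.Ioo (0 : ℝ) 1) {U : Circle → ℂ}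
    (hU : Continuous U) : Continuous fun s => ‖U s‖ ^ 2 / poissonDensity σ r s :=
  (hU.norm.pow 2).div (continuous_poissonDensity hr) fun s => (poissonDensity_pos hr s).ne'

theorem weightedEnergy_eq_ofReal [IsProbabilityMeasure σ] (hr : r ∈ Set.Ioo (0 : ℝ) 1)
    {U : Circle → ℂ} (hU : Continuous U) :
    weightedEnergy σ r U
      = ENNReal.ofReal (∫ s, ‖U s‖ ^ 2 / poissonDensity σ r s ∂circleLebesgue) :=
  (ofReal_integral_eq_lintegral_ofReal (continuous_energy hr hU).integrable_circle
    (ae_of_all _ fun s => div_nonneg (by positivity) (poissonDensity_pos hr s).le)).symm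

/-- Cauchy–Schwarz, with the weight `Re R` split between the two factors. -/
theorem norm_integral_mul_sq_le_of_weightedEnergy_le [IsProbabilityMeasure σ]
    (hr : r ∈ Set.Ioo (0 : ℝ) 1) {U g : Circle → ℂ} (hU : Continuous U) (hg : Continuous g)
    {S : ℝ} (hS : weightedEnergy σ r U ≤ ENNReal.ofReal (S ^ 2)) :
    ‖∫ s, g s * U s ∂circleLebesgue‖ ^ 2
      ≤ S ^ 2 * ∫ s, ‖g s‖ ^ 2 * poissonDensity σ r s ∂circleLebesgue := by
  have hpos := fun s => poissonDensity_pos (σ := σ) hr s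
  have hsq : Continuous fun s => ((√(poissonDensity σ r s) : ℝ) : ℂ) :=
    Complex.continuous_ofReal.comp (continuous_poissonDensity hr).sqrt
  have hne : ∀ s, ((√(poissonDensity σ r s) : ℝ) : ℂ) ≠ 0 := fun s => by
    exact_mod_cast (Real.sqrt_pos.2 (hpos s)).ne'
  have h := norm_integral_mul_sq_le (μ := circleLebesgue)
    (a := fun s => g s * ((√(poissonDensity σ r s) : ℝ) : ℂ))
    (b := fun s => U s / ((√(poissonDensity σ r s) : ℝ) : ℂ)) (hg.mul hsq).memLp_two_circle
    (hU.div hsq hne).memLp_two_circle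
  have h1 : ∀ s, g s * ((√(poissonDensity σ r s) : ℝ) : ℂ)
      * (U s / ((√(poissonDensity σ r s) : ℝ) : ℂ)) = g s * U s := fun s => by
    have := hne s
    field_simp
  have h2 : ∀ s, ‖g s * ((√(poissonDensity σ r s) : ℝ) : ℂ)‖ ^ 2
      = ‖g s‖ ^ 2 * poissonDensity σ r s := fun s => by
    rw [norm_mul, Complex.norm_real, Real.norm_eq_abs, mul_pow, sq_abs, Real.sq_sqrt (hpos s).le]
  have h3 : ∀ s, ‖U s / ((√(poissonDensity σ r s) : ℝ) : ℂ)‖ ^ 2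
      = ‖U s‖ ^ 2 / poissonDensity σ r s := fun s => by
    rw [norm_div, Complex.norm_real, Real.norm_eq_abs, div_pow, sq_abs, Real.sq_sqrt (hpos s).le]
  simp only [h1, h2, h3] at h
  rw [weightedEnergy_eq_ofReal hr hU, ENNReal.ofReal_le_ofReal_iff (sq_nonneg S)] at hS
  refine h.trans ?_
  rw [mul_comm]
  gcongr
  exact integral_nonneg fun s => mul_nonneg (by positivity) (hpos s).le

/-- As `r → 1` the weights `Re R(r s) dm(s)` converge to `σ`, so a uniform energy bound makes
limits of the pairings with `g` bounded in the norm of `L²(σ)`. -/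
theorem norm_le_of_tendsto_of_weightedEnergy_le [IsProbabilityMeasure σ] {U : ℝ → Circle → ℂ}
    (hU : ∀ r ∈ Set.Ioo (0 : ℝ) 1, Continuous (U r)) {S : ℝ} (hS0 : 0 ≤ S)
    (hS : ∀ r ∈ Set.Ioo (0 : ℝ) 1, weightedEnergy σ r (U r) ≤ ENNReal.ofReal (S ^ 2))
    {l : Filter ℝ} [l.NeBot] (hl : l ≤ 𝓝[<] 1) (g : C(Circle, ℂ)) {L : ℂ}
    (hL : Tendsto (fun r => ∫ s, g s * U r s ∂circleLebesgue) l (𝓝 L)) :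
    ‖L‖ ≤ S * ‖ContinuousMap.toLp (E := ℂ) 2 σ ℂ g‖ := by
  have hev : ∀ᶠ r : ℝ in l, r ∈ Set.Ioo (0 : ℝ) 1 := hl (Ioo_mem_nhdsLT one_pos)
  have hnorm : ‖ContinuousMap.toLp (E := ℂ) 2 σ ℂ g‖ ^ 2 = ∫ t, ‖g t‖ ^ 2 ∂σ := by
    rw [Lp_two_norm_sq]
    refine integral_congr_ae ?_
    filter_upwards [ContinuousMap.coeFn_toLp (p := 2) (𝕜 := ℂ) σ g] with t ht
    rw [ht]
  have h1 := le_of_tendsto_of_tendsto (hL.norm.pow 2)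
    (((tendsto_integral_norm_sq_mul_poissonDensity (σ := σ) g.continuous).mono_left hl).const_mul
      (S ^ 2)) (by
      filter_upwards [hev] with r hr
      exact norm_integral_mul_sq_le_of_weightedEnergy_le hr (hU r hr) g.continuous (hS r hr))
  rw [← hnorm, ← mul_pow] at h1
  exact le_of_sq_le_sq h1 (by positivity)

theorem norm_star_Lp_two (f : Lp ℂ 2 σ) : ‖star f‖ = ‖f‖ := by
  rw [← sq_eq_sq₀ (norm_nonneg _) (norm_nonneg _), Lp_two_norm_sq, Lp_two_norm_sq]
  refine integral_congr_ae ?_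
  filter_upwards [Lp.coeFn_star f] with t ht
  rw [ht, Pi.star_apply, norm_star]

/-- The inner product of `L²` is conjugate-linear in its first argument; `star` turns it into the
bilinear pairing `∫ h f dσ`. -/
theorem inner_star_left (f h : Lp ℂ 2 σ) : inner ℂ (star f) h = ∫ t, h t * f t ∂σ := by
  rw [L2.inner_def]
  refine integral_congr_ae ?_
  filter_upwards [Lp.coeFn_star f] with t ht
  rw [ht, Pi.star_apply, RCLike.inner_apply, RCLike.star_def, RCLike.conj_conj]

theorem inner_star_toLp [IsFiniteMeasure σ] (f : Lp ℂ 2 σ) (g : C(Circle, ℂ)) :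
    inner ℂ (star f) (ContinuousMap.toLp (E := ℂ) 2 σ ℂ g) = ∫ t, g t * f t ∂σ := by
  rw [inner_star_left]
  refine integral_congr_ae ?_
  filter_upwards [ContinuousMap.coeFn_toLp (p := 2) (𝕜 := ℂ) σ g] with t ht
  rw [ht]

theorem integrable_Lp_two [IsFiniteMeasure σ] (f : Lp ℂ 2 σ) : Integrable f σ :=
  (Lp.memLp f).integrable (by norm_num)

/-- Testing against continuous functions recovers the full `L²(σ)` norm. -/
theorem norm_le_of_weightedEnergy_poissonInt_le [IsProbabilityMeasure σ] (f : Lp ℂ 2 σ)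
    {S : ℝ} (hS0 : 0 ≤ S) (hS : ∀ r ∈ Set.Ioo (0 : ℝ) 1,
      weightedEnergy σ r (poissonInt σ f r) ≤ ENNReal.ofReal (S ^ 2)) : ‖f‖ ≤ S := by
  have hf := integrable_Lp_two f
  have key : ∀ h : Lp ℂ 2 σ, ‖(inner ℂ (star f) h : ℂ)‖ ≤ S * ‖h‖ := by
    intro h
    refine DenseRange.induction_on (ContinuousMap.toLp_denseRange ℂ σ ℂ (p := 2) (by simp)) h
      (isClosed_le (by fun_prop) (by fun_prop)) fun g => ?_
    rw [inner_star_toLp]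
    exact norm_le_of_tendsto_of_weightedEnergy_le (fun r hr => continuous_poissonInt hf hr) hS0 hS
      le_rfl g (tendsto_integral_mul_poissonInt hf g.continuous)
  have h1 := key (star f)
  rw [inner_self_eq_norm_sq_to_K, norm_pow, RCLike.norm_ofReal, abs_norm, norm_star_Lp_two] at h1
  rcases (norm_nonneg f).eq_or_lt with h0 | h0
  · rwa [← h0]
  · nlinarith

/-- The pointwise bound `|P[f dσ]|² ≤ P[σ] P[|f|² dσ]`, divided by `P[σ] = Re R` and integrated
over the circle, where `P[|f|² dσ]` has integral `‖f‖²`. -/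
theorem weightedEnergy_poissonInt_le [IsProbabilityMeasure σ] (f : Lp ℂ 2 σ)
    (hr : r ∈ Set.Ioo (0 : ℝ) 1) :
    weightedEnergy σ r (poissonInt σ f r) ≤ ENNReal.ofReal (‖f‖ ^ 2) := by
  have hf := integrable_Lp_two f
  have hf2 : Integrable (fun t => ((‖f t‖ ^ 2 : ℝ) : ℂ)) σ :=
    (Lp.memLp f).integrable_norm_pow (by norm_num : (2 : ℕ) ≠ 0) |>.ofReal
  have hpt : ∀ s, ‖poissonInt σ f r s‖ ^ 2 / poissonDensity σ r s
      ≤ (poissonInt σ (fun t => ((‖f t‖ ^ 2 : ℝ) : ℂ)) r s).re := by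
    intro s
    have hq : Continuous fun t => ((√(poissonKer r s t) : ℝ) : ℂ) :=
      Complex.continuous_ofReal.comp (continuous_poissonKer_right hr s).sqrt
    obtain ⟨C, hC⟩ := isCompact_univ.exists_bound_of_continuousOn hq.continuousOn
    have hqf : MemLp (fun t => ((√(poissonKer r s t) : ℝ) : ℂ) * f t) 2 σ :=
      (Lp.memLp f).of_le_mul (c := C) (hq.aestronglyMeasurable.mul hf.aestronglyMeasurable)
        (ae_of_all _ fun t => by
          rw [norm_mul]
          gcongr
          exact hC t trivial)
    have h := norm_integral_mul_sq_le hq.memLp_two_circle hqf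
    have hp := fun t => (poissonKer_pos hr s t).le
    have h1 : ∀ t, ((√(poissonKer r s t) : ℝ) : ℂ) * (((√(poissonKer r s t) : ℝ) : ℂ) * f t)
        = (poissonKer r s t : ℂ) * f t := fun t => by
      rw [← mul_assoc, ← Complex.ofReal_mul, Real.mul_self_sqrt (hp t)]
    have h2 : ∀ t, ‖((√(poissonKer r s t) : ℝ) : ℂ)‖ ^ 2 = poissonKer r s t := fun t => by
      rw [Complex.norm_real, Real.norm_eq_abs, sq_abs, Real.sq_sqrt (hp t)]
    simp only [norm_mul, mul_pow, h1, h2] at h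
    have h3 : poissonInt σ (fun t => ((‖f t‖ ^ 2 : ℝ) : ℂ)) r s
        = ((∫ t, poissonKer r s t * ‖f t‖ ^ 2 ∂σ : ℝ) : ℂ) := by
      rw [poissonInt, ← integral_complex_ofReal]
      simp only [Complex.ofReal_mul]
    rw [h3, Complex.ofReal_re, div_le_iff₀' (poissonDensity_pos hr s)]
    exact h
  have hcont := continuous_poissonInt hf2 hr
  rw [weightedEnergy_eq_ofReal hr (continuous_poissonInt hf hr)]
  refine ENNReal.ofReal_le_ofReal ?_
  refine (integral_mono (continuous_energy hr (continuous_poissonInt hf hr)).integrable_circle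
    (Complex.continuous_re.comp hcont).integrable_circle hpt).trans_eq ?_
  have h4 := integral_mul_poissonInt hf2 (continuous_const (y := (1 : ℂ))) hr
  have h5 : ∀ t, ∫ s, poissonKer r t s • (1 : ℂ) ∂circleLebesgue = 1 := fun t => by
    rw [integral_smul_const, integral_poissonKer hr, one_smul]
  simp only [one_mul, h5] at h4
  rw [integral_complex_ofReal] at h4
  have h6 := integral_re (hcont.integrable_circle (μ := circleLebesgue))
  rw [h4] at h6
  rw [Lp_two_norm_sq]
  exact h6.trans (Complex.ofReal_re _)

/-- Functions with bounded energy have boundary values in the weak sense: the limit functional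
on `C(𝕋)`, taken along an ultrafilter, is bounded in the norm of `L²(σ)`, hence represented by
some `f ∈ L²(σ)`. -/
theorem exists_Lp_of_weightedEnergy_le [IsProbabilityMeasure σ] {U : ℝ → Circle → ℂ}
    (hU : ∀ r ∈ Set.Ioo (0 : ℝ) 1, Continuous (U r)) {S : ℝ} (hS0 : 0 ≤ S)
    (hS : ∀ r ∈ Set.Ioo (0 : ℝ) 1, weightedEnergy σ r (U r) ≤ ENNReal.ofReal (S ^ 2)) :
    ∃ f : Lp ℂ 2 σ, ∀ (g : C(Circle, ℂ)) (L : ℂ),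
      Tendsto (fun r => ∫ s, g s * U r s ∂circleLebesgue) (𝓝[<] 1) (𝓝 L) →
        ∫ t, g t * f t ∂σ = L := by
  let l : Ultrafilter ℝ := Ultrafilter.of (𝓝[<] 1)
  have hl : (l : Filter ℝ) ≤ 𝓝[<] 1 := Ultrafilter.of_le _
  have hev : ∀ᶠ r : ℝ in l, r ∈ Set.Ioo (0 : ℝ) 1 := hl (Ioo_mem_nhdsLT one_pos)
  have hex : ∀ g : C(Circle, ℂ), ∃ L : ℂ,
      Tendsto (fun r => ∫ s, g s * U r s ∂circleLebesgue) l (𝓝 L) := by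
    intro g
    -- Near `r = 1` the pairings with `g` stay in a compact disc: the weighted norms of `g` converge
    -- to `I`, hence are eventually below `I + 1`.
    set I : ℝ := ∫ t, ‖g t‖ ^ 2 ∂σ with hI
    have hbd : ∀ᶠ r in (l : Filter ℝ), (∫ s, g s * U r s ∂circleLebesgue)
        ∈ Metric.closedBall (0 : ℂ) (√(S ^ 2 * (I + 1))) := by
      filter_upwards [hev, ((tendsto_integral_norm_sq_mul_poissonDensity (σ := σ)
        g.continuous).mono_left hl).eventually_lt_const (lt_add_one I)] with r hr hlt
      rw [mem_closedBall_zero_iff]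
      refine Real.le_sqrt_of_sq_le ?_
      refine (norm_integral_mul_sq_le_of_weightedEnergy_le hr (hU r hr) g.continuous
        (hS r hr)).trans ?_
      gcongr
    obtain ⟨L, -, hL⟩ := (isCompact_closedBall (0 : ℂ) (√(S ^ 2 * (I + 1)))).ultrafilter_le_nhds
      (l.map fun r => ∫ s, g s * U r s ∂circleLebesgue) (le_principal_iff.2 hbd)
    exact ⟨L, hL⟩
  choose Λ hΛ using hex
  have hint : ∀ r ∈ Set.Ioo (0 : ℝ) 1, ∀ g : C(Circle, ℂ),
      Integrable (fun s => g s * U r s) circleLebesgue := fun r hr g =>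
    (g.continuous.mul (hU r hr)).integrable_circle
  let Λl : C(Circle, ℂ) →ₗ[ℂ] ℂ :=
    { toFun := Λ
      map_add' := fun g h => by
        refine tendsto_nhds_unique (hΛ (g + h)) (((hΛ g).add (hΛ h)).congr' ?_)
        filter_upwards [hev] with r hr
        rw [← integral_add (hint r hr g) (hint r hr h)]
        simp only [ContinuousMap.add_apply, add_mul]
      map_smul' := fun c g => by
        refine tendsto_nhds_unique (hΛ (c • g)) (((hΛ g).const_mul c).congr' ?_)
        filter_upwards [hev] with r hr
        rw [← integral_const_mul]
        simp only [ContinuousMap.smul_apply, smul_eq_mul, mul_assoc] }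
  have hb : ∀ g, ‖Λl g‖ ≤ S * ‖(ContinuousMap.toLp (E := ℂ) 2 σ ℂ).toLinearMap g‖ := fun g =>
    norm_le_of_tendsto_of_weightedEnergy_le hU hS0 hS hl g (hΛ g)
  have hd : DenseRange (ContinuousMap.toLp (E := ℂ) 2 σ ℂ).toLinearMap :=
    ContinuousMap.toLp_denseRange ℂ σ ℂ (p := 2) (by simp)
  refine ⟨star ((InnerProductSpace.toDual ℂ (Lp ℂ 2 σ)).symm
    (Λl.extendOfNorm (ContinuousMap.toLp (E := ℂ) 2 σ ℂ).toLinearMap)), fun g L hL => ?_⟩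
  rw [← inner_star_toLp, star_star, InnerProductSpace.toDual_symm_apply]
  exact (LinearMap.extendOfNorm_eq hd ⟨S, hb⟩ g).trans
    (tendsto_nhds_unique (hΛ g) (hL.mono_left hl))

end

/-! ### Analyticity of Cauchy integrals and of the outer function -/

section

theorem continuous_cauchyKernel {z : ℂ} (hz : ‖z‖ ≠ 1) :
    Continuous fun t : Circle => (t : ℂ) / (t - z) :=
  Continuous.div (by fun_prop) (by fun_prop) fun t => coe_sub_ne_zero t hz

theorem abs_one_sub_norm_le (t : Circle) (z : ℂ) : |1 - ‖z‖| ≤ ‖(t : ℂ) - z‖ := by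
  simpa only [Circle.norm_coe] using abs_norm_sub_norm_le (t : ℂ) z

theorem norm_cauchyKernel_le {z : ℂ} (hz : ‖z‖ ≠ 1) (t : Circle) :
    ‖(t : ℂ) / (t - z)‖ ≤ |1 - ‖z‖|⁻¹ := by
  have : 0 < |1 - ‖z‖| := abs_pos.2 (sub_ne_zero.2 hz.symm)
  rw [norm_div, Circle.norm_coe, one_div]
  exact inv_anti₀ this (abs_one_sub_norm_le t z)

theorem integrable_cauchyKernel_mul {μ : Measure Circle} {f : Circle → ℂ} (hf : Integrable f μ)
    {z : ℂ} (hz : ‖z‖ ≠ 1) : Integrable (fun t : Circle => (t : ℂ) / (t - z) * f t) μ :=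
  hf.bdd_mul (c := |1 - ‖z‖|⁻¹) (continuous_cauchyKernel hz).aestronglyMeasurable
    (ae_of_all _ (norm_cauchyKernel_le hz))

theorem differentiableAt_cauchyInt {μ : Measure Circle} {f : Circle → ℂ} (hf : Integrable f μ)
    {z₀ : ℂ} (hz₀ : ‖z₀‖ ≠ 1) : DifferentiableAt ℂ (cauchyInt μ f) z₀ := by
  have hδ : 0 < |1 - ‖z₀‖| / 2 := half_pos (abs_pos.2 (sub_ne_zero.2 hz₀.symm))
  set δ := |1 - ‖z₀‖| / 2 with hδd
  have hnear : ∀ z ∈ Metric.ball z₀ δ, δ ≤ |1 - ‖z‖| := by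
    intro z hz
    have h1 : |‖z‖ - ‖z₀‖| < δ :=
      (abs_norm_sub_norm_le z z₀).trans_lt (by simpa [dist_eq_norm] using hz)
    have h2 := abs_sub_le 1 ‖z‖ ‖z₀‖
    linarith
  have hne : ∀ z ∈ Metric.ball z₀ δ, ‖z‖ ≠ 1 := by
    intro z hz h
    have := hnear z hz
    rw [h, sub_self, abs_zero] at this
    exact this.not_gt hδ
  have hmem : Metric.ball z₀ δ ∈ 𝓝 z₀ := Metric.ball_mem_nhds _ hδ
  refine (hasDerivAt_integral_of_dominated_loc_of_deriv_le (μ := μ)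
    (F := fun z t => (t : ℂ) / (t - z) * f t) (F' := fun z t => (t : ℂ) / (t - z) ^ 2 * f t)
    (bound := fun t => (δ ^ 2)⁻¹ * ‖f t‖) hmem ?_ (integrable_cauchyKernel_mul hf hz₀) ?_ ?_
    (hf.norm.const_mul _) ?_).2.differentiableAt
  · filter_upwards [hmem] with z hz
    exact (integrable_cauchyKernel_mul hf (hne z hz)).aestronglyMeasurable
  · refine (Continuous.aestronglyMeasurable ?_).mul hf.aestronglyMeasurable
    exact Continuous.div (by fun_prop) (by fun_prop) fun t =>
      pow_ne_zero 2 (coe_sub_ne_zero t hz₀)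
  · refine ae_of_all _ fun t z hz => ?_
    rw [norm_mul, norm_div, norm_pow, Circle.norm_coe, one_div]
    gcongr
    exact (hnear z hz).trans (abs_one_sub_norm_le t z)
  · refine ae_of_all _ fun t z hz => ?_
    have h := coe_sub_ne_zero t (hne z hz)
    have h1 : HasDerivAt (fun z => (t : ℂ) / (t - z)) ((0 * (t - z) - t * (-1)) / (t - z) ^ 2) z :=
      (hasDerivAt_const z (t : ℂ)).div ((hasDerivAt_id z).const_sub (t : ℂ)) h
    have h2 : (0 * ((t : ℂ) - z) - t * (-1)) / (t - z) ^ 2 = t / (t - z) ^ 2 := by ring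
    rw [h2] at h1
    exact h1.mul_const (f t)

theorem tendsto_cauchyInt_cobounded {μ : Measure Circle} {f : Circle → ℂ} (hf : Integrable f μ) :
    Tendsto (cauchyInt μ f) (Bornology.cobounded ℂ) (𝓝 0) := by
  have hlim : Tendsto (fun z : ℂ => (‖z‖ - 1)⁻¹ * ∫ t, ‖f t‖ ∂μ) (Bornology.cobounded ℂ)
      (𝓝 0) := by
    have h1 : Tendsto (fun z : ℂ => ‖z‖ - 1) (Bornology.cobounded ℂ) atTop :=
      tendsto_atTop_add_const_right _ (-1) tendsto_norm_cobounded_atTop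
    simpa using (tendsto_inv_atTop_zero.comp h1).mul_const (∫ t, ‖f t‖ ∂μ)
  refine squeeze_zero_norm' ?_ hlim
  filter_upwards [tendsto_norm_cobounded_atTop.eventually_gt_atTop 1] with z hz
  rw [cauchyInt, ← integral_const_mul]
  refine norm_integral_le_of_norm_le (hf.norm.const_mul _) (ae_of_all _ fun t => ?_)
  rw [norm_mul]
  gcongr
  refine (norm_cauchyKernel_le hz.ne' t).trans_eq ?_
  rw [abs_sub_comm, abs_of_pos (sub_pos.2 hz)]

variable {σ : Measure Circle} {a : Circle} {F : (ℂ → ℂ) × (ℂ → ℂ)}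

theorem outerD_ne_zero (z : ℂ) : outerD σ z ≠ 0 := Complex.exp_ne_zero _

theorem outerDStar_ne_zero (z : ℂ) : outerDStar σ z ≠ 0 :=
  (map_ne_zero _).2 (outerD_ne_zero _)

/-- Since `(t + z) / (t - z) = 2 t / (t - z) - 1`, the exponent of `D` is a Cauchy integral of
`log w` up to a constant; this is where `log w ∈ L¹(m)` enters. -/
theorem differentiableAt_outerD (hσ : IsSzego σ) {z₀ : ℂ} (hz₀ : ‖z₀‖ < 1) :
    DifferentiableAt ℂ (outerD σ) z₀ := by
  have hlog : Integrable (fun t => (Real.log (weight σ t) : ℂ)) circleLebesgue := hσ.2.ofReal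
  have hev : outerD σ =ᶠ[𝓝 z₀] fun z => Complex.exp ((1 / 2 : ℂ) *
      (2 * cauchyInt circleLebesgue (fun t => (Real.log (weight σ t) : ℂ)) z
        - ∫ t, (Real.log (weight σ t) : ℂ) ∂circleLebesgue)) := by
    filter_upwards [(isOpen_lt continuous_norm continuous_const).mem_nhds hz₀] with z hz
    have hz1 : ‖z‖ ≠ 1 := ne_of_lt hz
    have hpt : ∀ t : Circle, ((t : ℂ) + z) / (t - z) * (Real.log (weight σ t) : ℂ)
        = 2 * ((t : ℂ) / (t - z) * (Real.log (weight σ t) : ℂ)) - Real.log (weight σ t) := by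
      intro t
      have := coe_sub_ne_zero t hz1
      field_simp
      ring
    simp only [outerD, hpt]
    rw [integral_sub (f := fun t : Circle => 2 * ((t : ℂ) / (t - z) * (Real.log (weight σ t) : ℂ)))
        ((integrable_cauchyKernel_mul hlog hz1).const_mul 2) hlog, integral_const_mul, cauchyInt]
  refine DifferentiableAt.congr_of_eventuallyEq ?_ hev
  exact ((((differentiableAt_cauchyInt hlog hz₀.ne).const_mul _).sub_const _).const_mul _).cexp

theorem differentiableAt_outerDStar (hσ : IsSzego σ) {z : ℂ} (hz : 1 < ‖z‖) :
    DifferentiableAt ℂ (outerDStar σ) z := by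
  have hz0 : z ≠ 0 := norm_pos_iff.1 (one_pos.trans hz)
  have h1 : outerDStar σ = (conj ∘ outerD σ ∘ conj) ∘ fun z : ℂ => z⁻¹ := by
    ext z
    simp [outerDStar]
  rw [h1]
  have h2 : DifferentiableAt ℂ (outerD σ) (conj z⁻¹) := by
    refine differentiableAt_outerD hσ ?_
    rw [RCLike.norm_conj, norm_inv]
    exact inv_lt_one_of_one_lt₀ hz
  have h3 := h2.conj_conj
  rw [RCLike.conj_conj] at h3
  exact DifferentiableAt.comp z h3 (differentiableAt_inv hz0)

theorem tendsto_outerDStar_cobounded (hσ : IsSzego σ) :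
    Tendsto (outerDStar σ) (Bornology.cobounded ℂ) (𝓝 (conj (outerD σ 0))) := by
  have h1 : Tendsto (fun z : ℂ => 1 / conj z) (Bornology.cobounded ℂ) (𝓝 0) := by
    have h := (Complex.continuous_conj.tendsto 0).comp
      (tendsto_inv₀_cobounded (α := ℂ))
    simpa [Function.comp_def] using h
  have h2 := (differentiableAt_outerD hσ (z₀ := 0) (by simp)).continuousAt.tendsto.comp h1
  exact (Complex.continuous_conj.tendsto _).comp h2

theorem isOpen_norm_lt_one : IsOpen {z : ℂ | ‖z‖ < 1} := isOpen_lt continuous_norm continuous_const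

theorem isOpen_one_lt_norm : IsOpen {z : ℂ | 1 < ‖z‖} := isOpen_lt continuous_const continuous_norm

/-! ### Cauchy's formula for the two components -/

theorem integral_cauchyKernel_mul_inner {G : ℂ → ℂ} (hG : DifferentiableOn ℂ G {z | ‖z‖ < 1})
    {r : ℝ} (hr : r ∈ Set.Ioo (0 : ℝ) 1) {z : ℂ} (hz : ‖z‖ < 1) :
    ∫ t : Circle, (t : ℂ) / (t - z) * G (r * t) ∂circleLebesgue = G (r * z) := by
  refine integral_cauchyKernel_mul (H := fun ζ => G (r * ζ)) (s := {ζ : ℂ | ‖(r : ℂ) * ζ‖ < 1})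
    ?_ ?_ hz
  · intro ζ hζ
    rw [mem_closedBall_zero_iff] at hζ
    rw [Set.mem_ofPred_eq, norm_mul, Complex.norm_real, Real.norm_eq_abs, abs_of_pos hr.1]
    nlinarith [hr.1, hr.2, norm_nonneg ζ]
  · exact hG.comp (by fun_prop) fun ζ hζ => hζ

/-- For `|z| > 1` the integrand `t / (t - z) G(r t)` extends analytically to the disc and vanishes
at the origin. -/
theorem integral_cauchyKernel_mul_inner_of_one_lt {G : ℂ → ℂ}
    (hG : DifferentiableOn ℂ G {z | ‖z‖ < 1})
    {r : ℝ} (hr : r ∈ Set.Ioo (0 : ℝ) 1) {z : ℂ} (hz : 1 < ‖z‖) :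
    ∫ t : Circle, (t : ℂ) / (t - z) * G (r * t) ∂circleLebesgue = 0 := by
  rw [integral_of_differentiableOn (H := fun ζ => ζ / (ζ - z) * G (r * ζ))
    (s := {ζ : ℂ | ‖(r : ℂ) * ζ‖ < 1 ∧ ζ ≠ z})]
  · simp
  · intro ζ hζ
    rw [mem_closedBall_zero_iff] at hζ
    refine ⟨?_, fun h => ?_⟩
    · rw [norm_mul, Complex.norm_real, Real.norm_eq_abs, abs_of_pos hr.1]
      nlinarith [hr.1, hr.2, norm_nonneg ζ]
    · rw [h] at hζ
      linarith
  · refine (DifferentiableOn.div (by fun_prop) (by fun_prop) fun ζ hζ =>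
      sub_ne_zero.2 hζ.2).mul (hG.comp (by fun_prop) fun ζ hζ => hζ.1)

/-- Inversion turns a function analytic outside the closed disc and vanishing at infinity into
a function analytic in the disc and vanishing at the origin. -/
theorem exists_differentiableOn_inv {G : ℂ → ℂ} (hG : DifferentiableOn ℂ G {z | 1 < ‖z‖})
    (hG0 : Tendsto G (Bornology.cobounded ℂ) (𝓝 0)) :
    ∃ K : ℂ → ℂ, DifferentiableOn ℂ K {z | ‖z‖ < 1} ∧ K 0 = 0 ∧ ∀ z ≠ 0, K z = G z⁻¹ := by
  classical
  refine ⟨Function.update (fun z => G z⁻¹) 0 0, ?_, by simp, fun z hz => by simp [hz]⟩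
  refine (Complex.differentiableOn_compl_singleton_and_continuousAt_iff (c := 0)
    (isOpen_norm_lt_one.mem_nhds (by simp))).1 ⟨?_, ?_⟩
  · refine DifferentiableOn.congr (f := fun z => G z⁻¹) ?_ fun z hz => by
      simp [show z ≠ 0 from hz.2]
    refine hG.comp (differentiableOn_inv.mono fun z hz => hz.2) fun z hz => ?_
    rw [Set.mem_ofPred_eq, norm_inv]
    exact (one_lt_inv₀ (norm_pos_iff.2 hz.2)).2 hz.1
  · rw [continuousAt_update_same]
    exact hG0.comp tendsto_inv₀_nhdsNE_zero

theorem integral_cauchyKernel_mul_outer_eq {G K : ℂ → ℂ}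
    (hG : DifferentiableOn ℂ G {z | 1 < ‖z‖}) (hKG : ∀ z ≠ 0, K z = G z⁻¹)
    {r : ℝ} (hr : r ∈ Set.Ioo (0 : ℝ) 1) {z : ℂ} (hz : ‖z‖ ≠ 1) :
    ∫ t : Circle, (t : ℂ) / (t - z) * G (t / r) ∂circleLebesgue
      = ∫ t : Circle, (1 - t * z)⁻¹ * K (r * t) ∂circleLebesgue := by
  have hc : Continuous fun t : Circle => (t : ℂ) / (t - z) * G (t / r) :=
    (continuous_cauchyKernel hz).mul
      (hG.continuousOn.comp_continuous (by fun_prop) (one_lt_norm_coe_div hr))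
  rw [← integral_circleLebesgue_inv hc]
  refine integral_congr_ae (ae_of_all _ fun t => ?_)
  have hr0 : (r : ℂ) ≠ 0 := by exact_mod_cast hr.1.ne'
  have ht0 : (t : ℂ) ≠ 0 := t.coe_ne_zero
  simp only [Circle.coe_inv]
  rw [hKG _ (mul_ne_zero hr0 ht0)]
  congr 1
  · have : (t : ℂ)⁻¹ - z = (t : ℂ)⁻¹ * (1 - t * z) := by field_simp
    rw [this, div_mul_cancel_left₀ (inv_ne_zero ht0)]
  · rw [mul_inv, div_eq_mul_inv, mul_comm]

/-- After the inversion `t ↦ 1 / t` the integrand is analytic in the disc, with value `K(0) = 0` at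
the origin. -/
theorem integral_cauchyKernel_mul_outer_of_lt_one {G : ℂ → ℂ}
    (hG : DifferentiableOn ℂ G {z | 1 < ‖z‖}) (hG0 : Tendsto G (Bornology.cobounded ℂ) (𝓝 0))
    {r : ℝ} (hr : r ∈ Set.Ioo (0 : ℝ) 1) {z : ℂ} (hz : ‖z‖ < 1) :
    ∫ t : Circle, (t : ℂ) / (t - z) * G (t / r) ∂circleLebesgue = 0 := by
  obtain ⟨K, hK, hK0, hKG⟩ := exists_differentiableOn_inv hG hG0
  rw [integral_cauchyKernel_mul_outer_eq hG hKG hr hz.ne,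
    integral_of_differentiableOn (H := fun ζ => (1 - ζ * z)⁻¹ * K (r * ζ))
      (s := {ζ : ℂ | ‖(r : ℂ) * ζ‖ < 1 ∧ 1 - ζ * z ≠ 0})]
  · simp [hK0]
  · intro ζ hζ
    rw [mem_closedBall_zero_iff] at hζ
    refine ⟨?_, fun h => ?_⟩
    · rw [norm_mul, Complex.norm_real, Real.norm_eq_abs, abs_of_pos hr.1]
      nlinarith [hr.1, hr.2, norm_nonneg ζ]
    · have h1 : ‖ζ * z‖ = 1 := by rw [← sub_eq_zero.1 h, norm_one]
      rw [norm_mul] at h1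
      nlinarith [norm_nonneg ζ, norm_nonneg z]
  · exact (DifferentiableOn.inv (by fun_prop) fun ζ hζ => hζ.2).mul
      (hK.comp (by fun_prop) fun ζ hζ => hζ.1)

/-- Cauchy's formula for the exterior domain; the sign comes from its orientation. -/
theorem integral_cauchyKernel_mul_outer {G : ℂ → ℂ}
    (hG : DifferentiableOn ℂ G {z | 1 < ‖z‖}) (hG0 : Tendsto G (Bornology.cobounded ℂ) (𝓝 0))
    {r : ℝ} (hr : r ∈ Set.Ioo (0 : ℝ) 1) {z : ℂ} (hz : 1 < ‖z‖) :
    ∫ t : Circle, (t : ℂ) / (t - z) * G (t / r) ∂circleLebesgue = -G (z / r) := by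
  obtain ⟨K, hK, hK0, hKG⟩ := exists_differentiableOn_inv hG hG0
  have hz0 : z ≠ 0 := norm_pos_iff.1 (one_pos.trans hz)
  have hr0 : (r : ℂ) ≠ 0 := by exact_mod_cast hr.1.ne'
  have hzi : ‖z⁻¹‖ < 1 := by
    rw [norm_inv]
    exact inv_lt_one_of_one_lt₀ hz
  have hL : DifferentiableOn ℂ (dslope K 0) {z | ‖z‖ < 1} :=
    (Complex.differentiableOn_dslope (isOpen_norm_lt_one.mem_nhds (by simp))).2 hK
  -- With `L = dslope K 0`, the identity `K (r t) = r t L (r t)` supplies the factor `t` of the Cauchy kernel at `1 / z`.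
  have hKL : ∀ ζ ≠ 0, K ζ = ζ * dslope K 0 ζ := fun ζ hζ => by
    rw [dslope_of_ne _ hζ, slope_def_field, hK0]
    field_simp
    ring
  have h := integral_cauchyKernel_mul_inner hL hr hzi
  rw [integral_cauchyKernel_mul_outer_eq hG hKG hr hz.ne']
  have h1 : ∀ t : Circle, (1 - t * z)⁻¹ * K (r * t)
      = (-(r * z⁻¹)) * ((t : ℂ) / (t - z⁻¹) * dslope K 0 (r * t)) := fun t => by
    have h2 := coe_sub_ne_zero t hzi.ne
    rw [hKL _ (mul_ne_zero hr0 t.coe_ne_zero)]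
    have h3 : 1 - (t : ℂ) * z = -z * (t - z⁻¹) := by field_simp; ring
    rw [h3]
    field_simp
  simp only [h1]
  rw [integral_const_mul, h, neg_mul, ← hKL _ (mul_ne_zero hr0 (inv_ne_zero hz0)),
    hKG _ (mul_ne_zero hr0 (inv_ne_zero hz0)), mul_inv, inv_inv, div_eq_mul_inv, mul_comm z]

/-! ### The scattering representation -/

/-- The jump `(D F₁)(r t) - ā (D_* F₂)(t / r)` across the circle. -/
def jump (σ : Measure Circle) (a : Circle) (F : (ℂ → ℂ) × (ℂ → ℂ)) (r : ℝ) (t : Circle) : ℂ :=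
  outerD σ (r * (t : ℂ)) * F.1 (r * (t : ℂ))
    - conj (a : ℂ) * (outerDStar σ ((t : ℂ) / r) * F.2 ((t : ℂ) / r))

theorem hellingerIntegral_eq [IsFiniteMeasure σ] {r : ℝ} (hr : r ∈ Set.Ioo (0 : ℝ) 1) :
    hellingerIntegral σ a F r = weightedEnergy σ r (jump σ a F r) := by
  simp only [hellingerIntegral, weightedEnergy, jump, re_herglotzR hr]

/-- For a scattering transform the outer factors cancel and the jump of the Cauchy integral remains. -/
theorem jump_eq_poissonInt [IsFiniteMeasure σ] {f : Lp ℂ 2 σ}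
    (h : IsScatteringTransform σ a f F) {r : ℝ} (hr : r ∈ Set.Ioo (0 : ℝ) 1) :
    jump σ a F r = poissonInt σ f r := by
  ext s
  have hf := integrable_Lp_two f
  have h1 := norm_mul_coe_lt hr s
  have h2 := one_lt_norm_coe_div hr s
  have hD := outerD_ne_zero (σ := σ) (r * (s : ℂ))
  have hD' := outerDStar_ne_zero (σ := σ) ((s : ℂ) / r)
  have h3 : conj (a : ℂ) * (outerDStar σ ((s : ℂ) / r) * (a / outerDStar σ ((s : ℂ) / r)
      * cauchyInt σ f (s / r))) = cauchyInt σ f (s / r) := by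
    field_simp
    rw [mul_comm (conj (a : ℂ)), mul_conj_coe, one_mul]
  rw [jump, h.1 _ h1, h.2 _ h2, h3, ← mul_assoc, mul_one_div_cancel hD, one_mul, cauchyInt,
    cauchyInt, ← integral_sub (integrable_cauchyKernel_mul hf h1.ne)
      (integrable_cauchyKernel_mul hf h2.ne')]
  refine integral_congr_ae (ae_of_all _ fun t => ?_)
  simp only []
  rw [← sub_mul, cauchyKernel_sub hr]

/-- The norm identity: the supremum of the energies of `P[f dσ]` is at most `‖f‖²` by
Cauchy–Schwarz and at least `‖f‖²` by duality. -/
theorem mNorm_eq_enorm [IsProbabilityMeasure σ] {f : Lp ℂ 2 σ}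
    (h : IsScatteringTransform σ a f F) : mNorm σ a F = ‖f‖ₑ := by
  have hE : ∀ r ∈ Set.Ioo (0 : ℝ) 1,
      hellingerIntegral σ a F r = weightedEnergy σ r (poissonInt σ f r) := fun r hr => by
    rw [hellingerIntegral_eq hr, jump_eq_poissonInt h hr]
  set T := ⨆ r ∈ Set.Ioo (0 : ℝ) 1, hellingerIntegral σ a F r with hT
  have hle : T ≤ ENNReal.ofReal (‖f‖ ^ 2) :=
    iSup₂_le fun r hr => (hE r hr).trans_le (weightedEnergy_poissonInt_le f hr)
  have hfin : T ≠ ∞ := ne_top_of_le_ne_top ENNReal.ofReal_ne_top hle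
  have hS : ENNReal.ofReal (√T.toReal ^ 2) = T := by
    rw [Real.sq_sqrt ENNReal.toReal_nonneg, ENNReal.ofReal_toReal hfin]
  have hge : ‖f‖ ≤ √T.toReal :=
    norm_le_of_weightedEnergy_poissonInt_le f (Real.sqrt_nonneg _) fun r hr => by
      rw [hS, ← hE r hr]
      exact le_iSup₂ (f := fun r (_ : r ∈ Set.Ioo (0 : ℝ) 1) => hellingerIntegral σ a F r) r hr
  have hTe : T = ENNReal.ofReal (‖f‖ ^ 2) := by
    refine hle.antisymm ?_
    rw [← hS]
    gcongr
  rw [mNorm, ← hT, hTe, ENNReal.ofReal_rpow_of_nonneg (sq_nonneg _) (by norm_num),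
    ← Real.sqrt_eq_rpow, Real.sqrt_sq (norm_nonneg f), ofReal_norm]

theorem memM_of_isScatteringTransform [IsProbabilityMeasure σ] (hσ : IsSzego σ) {f : Lp ℂ 2 σ}
    (h : IsScatteringTransform σ a f F) : MemM σ a F := by
  have hf := integrable_Lp_two f
  refine ⟨?_, ?_, ?_, ?_⟩
  · refine DifferentiableOn.analyticOnNhd (DifferentiableOn.congr (f := fun z =>
      1 / outerD σ z * cauchyInt σ f z) (fun z hz => ?_) h.1) isOpen_norm_lt_one
    have hz' : ‖z‖ < 1 := hz
    exact (((differentiableAt_const _).div (differentiableAt_outerD hσ hz')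
      (outerD_ne_zero z)).mul (differentiableAt_cauchyInt hf hz'.ne)).differentiableWithinAt
  · refine DifferentiableOn.analyticOnNhd (DifferentiableOn.congr (f := fun z =>
      (a : ℂ) / outerDStar σ z * cauchyInt σ f z) (fun z hz => ?_) h.2) isOpen_one_lt_norm
    have hz' : 1 < ‖z‖ := hz
    exact (((differentiableAt_const _).div (differentiableAt_outerDStar hσ hz')
      (outerDStar_ne_zero z)).mul (differentiableAt_cauchyInt hf hz'.ne')).differentiableWithinAt
  · have hlim := (tendsto_const_nhds (x := (a : ℂ)) |>.div (tendsto_outerDStar_cobounded hσ)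
      ((map_ne_zero _).2 (outerD_ne_zero 0))).mul (tendsto_cauchyInt_cobounded hf)
    rw [mul_zero] at hlim
    refine hlim.congr' ?_
    filter_upwards [tendsto_norm_cobounded_atTop.eventually_gt_atTop 1] with z hz
      using (h.2 z hz).symm
  · rw [mNorm_eq_enorm h]
    exact enorm_lt_top

/-- The weak boundary value `f` of the jump, tested against the Cauchy kernel at `z`, recovers
`D F₁` inside the circle and `ā D_* F₂` outside. -/
theorem exists_isScatteringTransform [IsProbabilityMeasure σ] (hσ : IsSzego σ)
    (h : MemM σ a F) : ∃ f : Lp ℂ 2 σ, IsScatteringTransform σ a f F := by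
  obtain ⟨hF1, hF2, hF0, hfin⟩ := h
  set G₁ : ℂ → ℂ := fun z => outerD σ z * F.1 z with hG₁
  set G₂ : ℂ → ℂ := fun z => conj (a : ℂ) * (outerDStar σ z * F.2 z) with hG₂
  have hd1 : DifferentiableOn ℂ G₁ {z | ‖z‖ < 1} := fun z hz =>
    ((differentiableAt_outerD hσ hz).mul (hF1 z hz).differentiableAt).differentiableWithinAt
  have hd2 : DifferentiableOn ℂ G₂ {z | 1 < ‖z‖} := fun z hz =>
    (((differentiableAt_outerDStar hσ hz).mul
      (hF2 z hz).differentiableAt).const_mul _).differentiableWithinAt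
  have hlim2 : Tendsto G₂ (Bornology.cobounded ℂ) (𝓝 0) := by
    simpa using ((tendsto_outerDStar_cobounded hσ).mul hF0).const_mul (conj (a : ℂ))
  have hc1 : ∀ r ∈ Set.Ioo (0 : ℝ) 1, Continuous fun t : Circle => G₁ (r * t) := fun r hr =>
    hd1.continuousOn.comp_continuous (by fun_prop) (norm_mul_coe_lt hr)
  have hc2 : ∀ r ∈ Set.Ioo (0 : ℝ) 1, Continuous fun t : Circle => G₂ (t / r) := fun r hr =>
    hd2.continuousOn.comp_continuous (by fun_prop) (one_lt_norm_coe_div hr)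
  set T := ⨆ r ∈ Set.Ioo (0 : ℝ) 1, hellingerIntegral σ a F r with hT
  have hTfin : T ≠ ∞ := fun hTop => by
    rw [mNorm, ← hT, hTop, ENNReal.top_rpow_of_pos (by norm_num)] at hfin
    exact lt_irrefl _ hfin
  have hS : ENNReal.ofReal (√T.toReal ^ 2) = T := by
    rw [Real.sq_sqrt ENNReal.toReal_nonneg, ENNReal.ofReal_toReal hTfin]
  obtain ⟨f, hf⟩ := exists_Lp_of_weightedEnergy_le (σ := σ) (U := jump σ a F) (S := √T.toReal)
    (fun r hr => (hc1 r hr).sub (hc2 r hr)) (Real.sqrt_nonneg _) fun r hr => by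
      rw [hS, ← hellingerIntegral_eq hr]
      exact le_iSup₂ (f := fun r (_ : r ∈ Set.Ioo (0 : ℝ) 1) => hellingerIntegral σ a F r) r hr
  have hsplit : ∀ z : ℂ, ‖z‖ ≠ 1 → ∀ r ∈ Set.Ioo (0 : ℝ) 1,
      ∫ t : Circle, (t : ℂ) / (t - z) * jump σ a F r t ∂circleLebesgue
        = ∫ t : Circle, (t : ℂ) / (t - z) * G₁ (r * t) ∂circleLebesgue
          - ∫ t : Circle, (t : ℂ) / (t - z) * G₂ (t / r) ∂circleLebesgue := by
    intro z hz r hr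
    rw [← integral_sub (f := fun t : Circle => (t : ℂ) / (t - z) * G₁ (r * t))
      (g := fun t : Circle => (t : ℂ) / (t - z) * G₂ (t / r))
      ((continuous_cauchyKernel hz).mul (hc1 r hr)).integrable_circle
      ((continuous_cauchyKernel hz).mul (hc2 r hr)).integrable_circle]
    simp only [← mul_sub]
    rfl
  have hev : ∀ᶠ r : ℝ in 𝓝[<] 1, r ∈ Set.Ioo (0 : ℝ) 1 := Ioo_mem_nhdsLT one_pos
  have hcast : Tendsto (fun r : ℝ => (r : ℂ)) (𝓝[<] 1) (𝓝 1) := by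
    simpa using (Complex.continuous_ofReal.tendsto 1).mono_left nhdsWithin_le_nhds
  refine ⟨f, fun z hz => ?_, fun z hz => ?_⟩
  · have hlim : Tendsto (fun r : ℝ => G₁ (r * z)) (𝓝[<] 1) (𝓝 (G₁ z)) := by
      have h1 : Tendsto (fun r : ℝ => (r : ℂ) * z) (𝓝[<] 1) (𝓝 z) := by
        simpa using hcast.mul_const z
      exact ((hd1.differentiableAt (isOpen_norm_lt_one.mem_nhds hz)).continuousAt.tendsto).comp h1
    have hC : cauchyInt σ f z = G₁ z := by
      refine hf ⟨_, continuous_cauchyKernel hz.ne⟩ _ (hlim.congr' ?_)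
      filter_upwards [hev] with r hr
      rw [ContinuousMap.coe_mk, hsplit z hz.ne r hr, integral_cauchyKernel_mul_inner hd1 hr hz,
        integral_cauchyKernel_mul_outer_of_lt_one hd2 hlim2 hr hz, sub_zero]
    have hD := outerD_ne_zero (σ := σ) z
    rw [hC, hG₁]
    field_simp
  · have hlim : Tendsto (fun r : ℝ => G₂ (z / r)) (𝓝[<] 1) (𝓝 (G₂ z)) := by
      have h1 : Tendsto (fun r : ℝ => z / (r : ℂ)) (𝓝[<] 1) (𝓝 z) := by
        have h2 := (tendsto_const_nhds (x := z)).div hcast one_ne_zero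
        rwa [div_one] at h2
      exact ((hd2.differentiableAt (isOpen_one_lt_norm.mem_nhds hz)).continuousAt.tendsto).comp h1
    have hC : cauchyInt σ f z = G₂ z := by
      refine hf ⟨_, continuous_cauchyKernel hz.ne'⟩ _ (hlim.congr' ?_)
      filter_upwards [hev] with r hr
      rw [ContinuousMap.coe_mk, hsplit z hz.ne' r hr,
        integral_cauchyKernel_mul_inner_of_one_lt hd1 hr hz,
        integral_cauchyKernel_mul_outer hd2 hlim2 hr hz, zero_sub, neg_neg]
    have hD := outerDStar_ne_zero (σ := σ) z
    rw [hC, hG₂]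
    calc F.2 z = ((a : ℂ) * conj (a : ℂ)) * F.2 z := by rw [mul_conj_coe, one_mul]
      _ = _ := by field_simp

end

end Scattering

end

theorem mainTheorem9 (σ : Measure Circle) [IsProbabilityMeasure σ]
    (hσ : Scattering.IsSzego σ) (a : Circle) :
    (∀ F : (ℂ → ℂ) × (ℂ → ℂ),
      Scattering.MemM σ a F ↔
        ∃ f : Lp ℂ 2 σ, Scattering.IsScatteringTransform σ a f F) ∧
    (∀ (F : (ℂ → ℂ) × (ℂ → ℂ)) (f : Lp ℂ 2 σ),
      Scattering.IsScatteringTransform σ a f F → Scattering.mNorm σ a F = ‖f‖ₑ) :=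
  ⟨fun _ => ⟨Scattering.exists_isScatteringTransform hσ,
    fun ⟨_, h⟩ => Scattering.memM_of_isScatteringTransform hσ h⟩,
    fun _ _ h => Scattering.mNorm_eq_enorm h⟩
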